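/- Let $F$ be a field, let $L=L(X)$ be the free Lie algebra over $F$ with a finite free basis $X$, and let $H$ be a finitely generated Lie subalgebra of $L$ with $H\neq L$. Then there is a Lie subalgebra $C$ of $L$ with $H\subsetneq C$ such that $H$ is a free factor of $C$; that is, there is a Lie subalgebra $K\subseteq C$ such that $C=H\ast K$ is the free product (the coproduct in the category of Lie algebras over $F$, with respect to the inclusion maps) of $H$ and $K$. Suppose in addition that $H$ is homogeneous, i.e. that $H$ contains all homogeneous components of its elements with respect to the grading $L=\bigoplus_{n\ge 1}L_n$, where $L_n$ is the linear span of the commutators of degree $n$ in the elements of $X$ (each element of $X$ having degree $1$). Then $C\supsetneq H$ can be chosen to be, moreover, a subideal of $L$: there are $\ell\ge 1$ and a chain of subalgebras $L=C_0\supseteq C_1\supseteq\dots\supseteq C_\ell=C$ in which each $C_{i+1}$ is an ideal of $C_i$. -/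

import Mathlib

universe u v w

namespace LieSub

section General

variable {F : Type u} [CommRing F] {L : Type w} [LieRing L] [LieAlgebra F L]

/-- A Lie subalgebra is finitely generated if it is the Lie span of a finite set. -/
def IsFG (H : LieSubalgebra F L) : Prop :=
  ∃ s : Finset L, LieSubalgebra.lieSpan F L (s : Set L) = H

/-- `M` is contained in `N` and is an ideal of the Lie algebra `N`. -/
def IsIdealOf (M N : LieSubalgebra F L) : Prop :=
  M ≤ N ∧ ∀ x ∈ N, ∀ y ∈ M, ⁅x, y⁆ ∈ M

/-- `M` is an `ℓ`-subideal of `L`: there is a chain `L = L₀ ▷ L₁ ▷ ⋯ ▷ L_ℓ = M` of subalgebras,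
each of which is an ideal in the preceding one. -/
def IsSubidealOfLength (ℓ : ℕ) (M : LieSubalgebra F L) : Prop :=
  ∃ c : ℕ → LieSubalgebra F L,
    c 0 = ⊤ ∧ c ℓ = M ∧ ∀ i < ℓ, IsIdealOf (c (i + 1)) (c i)

/-- `M` is a subideal of `L`: an `ℓ`-subideal for some `ℓ ≥ 1`. -/
def IsSubideal (M : LieSubalgebra F L) : Prop :=
  ∃ ℓ : ℕ, 1 ≤ ℓ ∧ IsSubidealOfLength ℓ M

/-- `C` is the (internal) free product `H ∗ K` of its subalgebras `H` and `K`: the inclusions of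
`H` and `K` make `C` the coproduct of `H` and `K` in the category of Lie algebras over `F`.
(The free product of `H` and `K` can be constructed in the universe `max u w`, so test algebras
in that universe determine it.) -/
def IsFreeProduct (H K C : LieSubalgebra F L) : Prop :=
  ∃ (hH : H ≤ C) (hK : K ≤ C),
    ∀ (M : Type (max u w)) [LieRing M] [LieAlgebra F M] (f : H →ₗ⁅F⁆ M) (g : K →ₗ⁅F⁆ M),
      ∃! h : C →ₗ⁅F⁆ M,
        h.comp (LieSubalgebra.inclusion hH) = f ∧ h.comp (LieSubalgebra.inclusion hK) = g

/-- `H` is a free factor of `C`: there is a subalgebra `K` of `C` with `C = H ∗ K`. -/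
def IsFreeFactor (H C : LieSubalgebra F L) : Prop :=
  ∃ K : LieSubalgebra F L, IsFreeProduct H K C

end General

section Free

variable (F : Type u) [CommRing F] (X : Type v)

/-- The commutators of degree `n` in the free generators: the generators have degree `1`, and the
bracket of commutators of degrees `k` and `l` is a commutator of degree `k + l`. -/
inductive IsCommutator : ℕ → FreeLieAlgebra F X → Prop
  | of (x : X) : IsCommutator 1 (FreeLieAlgebra.of F x)
  | bracket {k l : ℕ} {c d : FreeLieAlgebra F X} :
      IsCommutator k c → IsCommutator l d → IsCommutator (k + l) ⁅c, d⁆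

/-- The homogeneous component of degree `n` of the free Lie algebra: the linear span of the
commutators of degree `n`. -/
noncomputable def component (n : ℕ) : Submodule F (FreeLieAlgebra F X) :=
  Submodule.span F {c | IsCommutator F X n c}

variable {F X}

/-- A subalgebra of the free Lie algebra is homogeneous (graded) if it contains all homogeneous
components of its elements: whenever a finite sum `∑ uₙ` with `uₙ` homogeneous of degree `n` lies
in `H`, so does every `uₙ`. -/
def IsHomogeneous (H : LieSubalgebra F (FreeLieAlgebra F X)) : Prop :=
  ∀ a : ℕ →₀ FreeLieAlgebra F X, (∀ n, a n ∈ component F X n) →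
    (a.sum fun _ y => y) ∈ H → ∀ n, a n ∈ H

end Free

end LieSub

/-! Filter $L$ by degree and replace $H$ by its leading terms. For each $n$, let $T_n$ (`truncation
H n`) be the graded subalgebra that agrees with the leading terms of $H$ in degrees below $n$ and
contains everything in degrees at least $n$. Then $T_0=L$ and each $T_{n+1}$ is an ideal of $T_n$,
so every $T_n$ with $n\ge 1$ is a subideal.

Since $X$ is finite, $T_n$ has finite codimension. A proper graded subalgebra of finite codimension
is an ideal of codimension one in a larger graded subalgebra $D$ (`exists_codim_one_extension`).
Lazard elimination turns homogeneous free generators of $D$ into homogeneous free generators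
$(\mathrm{ad}\,z)^k y$ of the ideal (`IsGradedFree.exists_of_codim_one`). Induction on the
codimension gives homogeneous free generators $b_i$ of $T_n$; when $T_n\ne L$ and $X$ has at least
two elements, their degrees are unbounded.

Lift each $b_i$ of degree below $n$ to an element $h_i$ of $H$ with leading term $b_i$, and put
$h_i=b_i$ in the other degrees. Lower-order perturbations preserve freeness
(`injective_lift_of_leading`). For large $n$, finite generation of $H$ and descent on leading terms
show that the $h_i$ of degree below $n$ generate $H$ (`mem_lieSpan_of_mem_below`). The remaining
$h_i$ generate a nonzero complementary free factor. If $H$ is homogeneous, the leading terms already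
lie in $H$, so $h=b$ works and $C=T_n$. -/

namespace LieSub

open scoped TensorProduct

/-! ### Subalgebras generated by a family. -/

section Generation

variable {F : Type u} [CommRing F] {ι : Type v}

theorem eq_top_of_forall_of_mem (T : LieSubalgebra F (FreeLieAlgebra F ι))
    (h : ∀ i, FreeLieAlgebra.of F i ∈ T) : T = ⊤ := by
  let g : FreeLieAlgebra F ι →ₗ⁅F⁆ T :=
    FreeLieAlgebra.lift F fun i => ⟨FreeLieAlgebra.of F i, h i⟩
  have hg : T.incl.comp g = LieHom.id := by
    ext i
    simp [g]
  rw [eq_top_iff]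
  intro x _
  have := congrArg (fun f => f x) hg
  simp only [LieHom.comp_apply, LieSubalgebra.coe_incl, LieHom.id_apply] at this
  rw [← this]
  exact (g x).2

theorem range_lift {L : Type w} [LieRing L] [LieAlgebra F L] (b : ι → L) :
    (FreeLieAlgebra.lift F b).range = LieSubalgebra.lieSpan F L (Set.range b) := by
  apply le_antisymm
  · rintro _ ⟨x, rfl⟩
    have h := eq_top_of_forall_of_mem
      ((LieSubalgebra.lieSpan F L (Set.range b)).comap (FreeLieAlgebra.lift F b))
      (fun i => by simpa using LieSubalgebra.subset_lieSpan (Set.mem_range_self i))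
    have hx : x ∈ (LieSubalgebra.lieSpan F L (Set.range b)).comap (FreeLieAlgebra.lift F b) :=
      h ▸ LieSubalgebra.mem_top x
    exact hx
  · rw [LieSubalgebra.lieSpan_le]
    rintro _ ⟨i, rfl⟩
    exact ⟨FreeLieAlgebra.of F i, by simp⟩

end Generation

/-! ### Gradings of a free Lie algebra by arbitrary weights of the generators. -/

section Grading

variable {F : Type u} [CommRing F] {ι : Type v}

/-- The homomorphism multiplying each generator `i` by the monomial of degree `d i`. -/
noncomputable def weightHom (d : ι → ℕ) :
    FreeLieAlgebra F ι →ₗ⁅F⁆ LieAlgebra.loopAlgebra F ℕ (FreeLieAlgebra F ι) :=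
  FreeLieAlgebra.lift F fun i => AddMonoidAlgebra.single (d i) (1 : F) ⊗ₜ[F] FreeLieAlgebra.of F i

/-- The elements of weight `k` when the generator `i` has weight `d i`. -/
noncomputable def homog (d : ι → ℕ) (k : ℕ) : Submodule F (FreeLieAlgebra F ι) :=
  LinearMap.eqLocus (weightHom (F := F) d : FreeLieAlgebra F ι →ₗ[F] _)
    (TensorProduct.mk F (AddMonoidAlgebra F ℕ) (FreeLieAlgebra F ι)
      (AddMonoidAlgebra.single k (1 : F)))

/-- The finitely supported family of the components of an element. -/
noncomputable def components (d : ι → ℕ) : FreeLieAlgebra F ι →ₗ[F] ℕ →₀ FreeLieAlgebra F ι :=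
  (LieAlgebra.LoopAlgebra.toFinsupp F ℕ (FreeLieAlgebra F ι)).toLinearMap ∘ₗ
    (weightHom (F := F) d : FreeLieAlgebra F ι →ₗ[F] _)

/-- The component of weight `k`. -/
noncomputable def proj (d : ι → ℕ) (k : ℕ) : FreeLieAlgebra F ι →ₗ[F] FreeLieAlgebra F ι :=
  Finsupp.lapply k ∘ₗ components d

variable {d : ι → ℕ}

theorem mem_homog {k : ℕ} {u : FreeLieAlgebra F ι} :
    u ∈ homog d k ↔ weightHom (F := F) d u = AddMonoidAlgebra.single k (1 : F) ⊗ₜ[F] u := Iff.rfl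

theorem of_mem_homog (d : ι → ℕ) (i : ι) : FreeLieAlgebra.of F i ∈ homog d (d i) := by
  simp [mem_homog, weightHom]

theorem lie_mem_homog {k l : ℕ} {u v : FreeLieAlgebra F ι} (hu : u ∈ homog d k)
    (hv : v ∈ homog d l) : ⁅u, v⁆ ∈ homog d (k + l) := by
  rw [mem_homog] at *
  rw [LieHom.map_lie, hu, hv, LieAlgebra.ExtendScalars.bracket_tmul,
    AddMonoidAlgebra.single_mul_single, one_mul]

/-- A family of submodules of homogeneous elements that contains the generators and is compatible
with the bracket exhausts the free Lie algebra. -/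
theorem iSup_eq_top_of_graded (S : ℕ → Submodule F (FreeLieAlgebra F ι))
    (hof : ∀ i : ι, FreeLieAlgebra.of F i ∈ S (d i))
    (hlie : ∀ k l, ∀ u ∈ S k, ∀ v ∈ S l, ⁅u, v⁆ ∈ S (k + l)) : ⨆ k, S k = ⊤ := by
  have key : ∀ u ∈ ⨆ k, S k, ∀ v ∈ ⨆ k, S k, ⁅u, v⁆ ∈ ⨆ k, S k := by
    intro u hu v hv
    induction hu using Submodule.iSup_induction' with
    | zero => simp
    | add x y _ _ hx hy => rw [add_lie]; exact add_mem hx hy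
    | mem k u hu =>
      induction hv using Submodule.iSup_induction' with
      | zero => simp
      | add x y _ _ hx hy => rw [lie_add]; exact add_mem hx hy
      | mem l v hv => exact Submodule.mem_iSup_of_mem _ (hlie k l u hu v hv)
  let T : LieSubalgebra F (FreeLieAlgebra F ι) := 
    { (⨆ k, S k) with lie_mem' := fun {x y} hx hy => key x hx y hy }
  rw [eq_top_iff]
  intro x _
  have hT : x ∈ T := eq_top_of_forall_of_mem T (fun i => Submodule.mem_iSup_of_mem (d i) (hof i)) ▸
    LieSubalgebra.mem_top x
  exact hT

theorem iSup_homog (d : ι → ℕ) : ⨆ k, homog (F := F) d k = ⊤ :=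
  iSup_eq_top_of_graded (d := d) _ (of_mem_homog d) fun _ _ _ hu _ hv => lie_mem_homog hu hv

theorem components_of_mem {k : ℕ} {u : FreeLieAlgebra F ι} (hu : u ∈ homog d k) :
    components d u = Finsupp.single k u := by
  rw [mem_homog] at hu
  simp [components, hu]

theorem proj_of_mem {k : ℕ} {u : FreeLieAlgebra F ι} (hu : u ∈ homog d k) : proj d k u = u := by
  simp [proj, components_of_mem hu]

theorem proj_of_mem_of_ne {j k : ℕ} {u : FreeLieAlgebra F ι} (hu : u ∈ homog d k) (h : j ≠ k) :
    proj d j u = 0 := by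
  simp [proj, components_of_mem hu, h.symm]

theorem proj_mem (d : ι → ℕ) (k : ℕ) (u : FreeLieAlgebra F ι) : proj d k u ∈ homog d k := by
  have hu : u ∈ ⨆ k, homog (F := F) d k := by rw [iSup_homog]; trivial
  induction hu using Submodule.iSup_induction' with
  | zero => simp
  | add x y _ _ hx hy => rw [map_add]; exact add_mem hx hy
  | mem l u hu =>
    by_cases h : k = l
    · subst h; rwa [proj_of_mem hu]
    · rw [proj_of_mem_of_ne hu h]; exact zero_mem _

theorem sum_components (d : ι → ℕ) (u : FreeLieAlgebra F ι) :
    ((components d u).sum fun _ y => y) = u := by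
  have hu : u ∈ ⨆ k, homog (F := F) d k := by rw [iSup_homog]; trivial
  induction hu using Submodule.iSup_induction' with
  | zero => simp
  | add x y _ _ hx hy =>
    rw [map_add, Finsupp.sum_add_index' (by simp) (by simp), hx, hy]
  | mem l u hu => simp [components_of_mem hu]

/-- The elements all of whose components have weight less than `N`. -/
noncomputable def below (d : ι → ℕ) (N : ℕ) : Submodule F (FreeLieAlgebra F ι) :=
  ⨅ k, ⨅ _ : N ≤ k, LinearMap.ker (proj d k)

theorem mem_below {N : ℕ} {u : FreeLieAlgebra F ι} :
    u ∈ below d N ↔ ∀ k, N ≤ k → proj d k u = 0 := by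
  simp [below, Submodule.mem_iInf]

theorem below_mono {M N : ℕ} (h : M ≤ N) : below (F := F) d M ≤ below d N := by
  intro u hu
  rw [mem_below] at *
  exact fun k hk => hu k (h.trans hk)

theorem homog_le_below {k N : ℕ} (h : k < N) : homog (F := F) d k ≤ below d N := by
  intro u hu
  rw [mem_below]
  exact fun j hj => proj_of_mem_of_ne hu (by omega)

theorem exists_mem_below (d : ι → ℕ) (u : FreeLieAlgebra F ι) : ∃ N, u ∈ below d N := by
  refine ⟨(components d u).support.sup id + 1, mem_below.2 fun k hk => ?_⟩
  by_contra h
  have : k ∈ (components d u).support := by simpa [proj] using h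
  have := Finset.le_sup (f := id) this
  simp only [id] at this
  omega

theorem sum_range_proj {N : ℕ} {u : FreeLieAlgebra F ι} (hu : u ∈ below d N) :
    ∑ k ∈ Finset.range N, proj d k u = u := by
  conv_rhs => rw [← sum_components d u]
  rw [Finsupp.sum_of_support_subset (s := Finset.range N)]
  · rfl
  · intro k hk
    rw [Finset.mem_range]
    by_contra h
    exact (Finsupp.mem_support_iff.1 hk) (mem_below.1 hu k (by omega))
  · simp

theorem mem_of_forall_proj_mem {S : Submodule F (FreeLieAlgebra F ι)} {u : FreeLieAlgebra F ι}
    (h : ∀ k, proj d k u ∈ S) : u ∈ S := by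
  obtain ⟨N, hN⟩ := exists_mem_below d u
  rw [← sum_range_proj hN]
  exact sum_mem fun k _ => h k

theorem below_zero (d : ι → ℕ) : below (F := F) d 0 = ⊥ := by
  rw [eq_bot_iff]
  intro u hu
  simpa using (sum_range_proj hu).symm

/-- Induction for homogeneous elements along brackets of homogeneous elements. -/
theorem homog_le_of_graded (S : ℕ → Submodule F (FreeLieAlgebra F ι))
    (hof : ∀ i : ι, FreeLieAlgebra.of F i ∈ S (d i))
    (hlie : ∀ k l, ∀ u ∈ S k, ∀ v ∈ S l, u ∈ homog d k → v ∈ homog d l → ⁅u, v⁆ ∈ S (k + l))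
    (k : ℕ) : homog d k ≤ S k := by
  -- Intersecting with `homog d k` ensures that the component of weight `k` picks out only the
  -- contribution of `S k`.
  have h := iSup_eq_top_of_graded (d := d) (fun k => S k ⊓ homog d k)
    (fun i => ⟨hof i, of_mem_homog d i⟩)
    (fun k l u hu v hv => ⟨hlie k l u hu.1 v hv.1 hu.2 hv.2, lie_mem_homog hu.2 hv.2⟩)
  have key : ∀ u : FreeLieAlgebra F ι, proj d k u ∈ S k := by
    intro u
    have hu : u ∈ ⨆ k, S k ⊓ homog d k := by rw [h]; trivial
    induction hu using Submodule.iSup_induction' with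
    | zero => simp
    | add x y _ _ hx hy => rw [map_add]; exact add_mem hx hy
    | mem l u hu =>
      by_cases h : k = l
      · subst h; rw [proj_of_mem hu.2]; exact hu.1
      · rw [proj_of_mem_of_ne hu.2 h]; exact zero_mem _
  intro u hu
  rw [← proj_of_mem hu]
  exact key u

theorem proj_proj (d : ι → ℕ) (j k : ℕ) (u : FreeLieAlgebra F ι) :
    proj d j (proj d k u) = if j = k then proj d k u else 0 := by
  split_ifs with h
  · subst h; exact proj_of_mem (proj_mem d j u)
  · exact proj_of_mem_of_ne (proj_mem d k u) h

/-- To prove that a component of a bracket lies in a submodule it suffices to treat the brackets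
of components. -/
theorem proj_lie_mem {S : Submodule F (FreeLieAlgebra F ι)} {k : ℕ} {u v : FreeLieAlgebra F ι}
    (h : ∀ i j, i + j = k → ⁅proj d i u, proj d j v⁆ ∈ S) : proj d k ⁅u, v⁆ ∈ S := by
  obtain ⟨M, hM⟩ := exists_mem_below d u
  obtain ⟨N, hN⟩ := exists_mem_below d v
  rw [← sum_range_proj hM, ← sum_range_proj hN, sum_lie_sum, map_sum]
  refine sum_mem fun i _ => ?_
  rw [map_sum]
  refine sum_mem fun j _ => ?_
  have hij := lie_mem_homog (proj_mem d i u) (proj_mem d j v)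
  by_cases hk : i + j = k
  · subst hk
    rw [proj_of_mem hij]
    exact h i j rfl
  · rw [proj_of_mem_of_ne hij (Ne.symm hk)]
    exact zero_mem _

/-- The bounds are strict: the factors have components of degree at most `m - 1` and `l`, so the
bracket stays strictly below `m + l`. -/
theorem lie_mem_below {m l : ℕ} {u v : FreeLieAlgebra F ι} (hu : u ∈ below d m)
    (hv : v ∈ below d (l + 1)) : ⁅u, v⁆ ∈ below d (m + l) := by
  refine mem_below.2 fun k hk => ?_
  rw [← Submodule.mem_bot F]
  refine proj_lie_mem fun i j hij => ?_
  by_cases hj : l + 1 ≤ j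
  · rw [mem_below.1 hv j hj]
    simp
  · rw [mem_below.1 hu i (by omega)]
    simp

theorem mem_below_of_proj_eq_zero {N : ℕ} {u : FreeLieAlgebra F ι} (hu : u ∈ below d (N + 1))
    (h : proj d N u = 0) : u ∈ below d N := by
  refine mem_below.2 fun k hk => ?_
  rcases hk.eq_or_lt with rfl | hk
  · exact h
  · exact mem_below.1 hu k hk

theorem sub_proj_mem_below {N : ℕ} {u : FreeLieAlgebra F ι} (hu : u ∈ below d (N + 1)) :
    u - proj d N u ∈ below d N := by
  refine mem_below_of_proj_eq_zero
    (sub_mem hu (homog_le_below N.lt_succ_self (proj_mem d N u))) ?_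
  rw [map_sub, proj_proj, if_pos rfl, sub_self]

theorem homog_one_eq_component (k : ℕ) : homog (fun _ : ι => 1) k = component F ι k := by
  apply le_antisymm
  · refine homog_le_of_graded _ (fun i => Submodule.subset_span (IsCommutator.of i)) ?_ k
    intro k l u hu v hv h1 h2
    clear h1 h2
    induction hu using Submodule.span_induction with
    | zero => simp
    | add x y _ _ hx hy => rw [add_lie]; exact add_mem hx hy
    | smul a x _ hx => rw [smul_lie]; exact Submodule.smul_mem _ _ hx
    | mem u hu =>
      induction hv using Submodule.span_induction with
      | zero => simp
      | add x y _ _ hx hy => rw [lie_add]; exact add_mem hx hy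
      | smul a x _ hx => rw [lie_smul]; exact Submodule.smul_mem _ _ hx
      | mem v hv => exact Submodule.subset_span (IsCommutator.bracket hu hv)
  · refine Submodule.span_le.2 fun c hc => ?_
    induction (show IsCommutator F ι k c from hc) with
    | of x => exact of_mem_homog (fun _ => 1) x
    | bracket h1 h2 ih1 ih2 => exact lie_mem_homog (ih1 h1) (ih2 h2)

theorem IsCommutator.one_le {k : ℕ} {c : FreeLieAlgebra F ι} (h : IsCommutator F ι k c) :
    1 ≤ k := by
  induction h with
  | of x => exact le_rfl
  | bracket _ _ h _ => omega

/-- Both factors of a bracket have degree at least 1, hence degree less than that of the bracket, so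
strong induction applies. -/
theorem finite_setOf_isCommutator [Finite ι] (k : ℕ) :
    {c | IsCommutator F ι k c}.Finite := by
  induction k using Nat.strong_induction_on with
  | _ k ih =>
    have hfin : ((Set.range (FreeLieAlgebra.of F : ι → FreeLieAlgebra F ι)) ∪
        ⋃ i ∈ Finset.range k, ⋃ j ∈ Finset.range k,
          Set.image2 (fun c e => ⁅c, e⁆) {c | IsCommutator F ι i c}
            {c | IsCommutator F ι j c}).Finite := by
      refine (Set.finite_range _).union ?_
      refine Set.Finite.biUnion (Finset.finite_toSet _) fun i hi => ?_
      refine Set.Finite.biUnion (Finset.finite_toSet _) fun j hj => ?_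
      exact Set.Finite.image2 _ (ih i (by simpa using hi)) (ih j (by simpa using hj))
    refine hfin.subset fun c hc => ?_
    cases (show IsCommutator F ι k c from hc) with
    | of x => exact Or.inl ⟨x, rfl⟩
    | @bracket i j a b h1 h2 =>
      have := h1.one_le
      have := h2.one_le
      refine Or.inr (Set.mem_biUnion (x := i) (by simp; omega)
        (Set.mem_biUnion (x := j) (by simp; omega) ⟨a, h1, b, h2, rfl⟩))

theorem homog_one_zero : homog (F := F) (fun _ : ι => 1) 0 = ⊥ := by
  rw [homog_one_eq_component, component, Submodule.span_eq_bot]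
  intro c hc
  exact absurd (show IsCommutator F ι 0 c from hc).one_le (by omega)

theorem finite_below [Finite ι] (N : ℕ) :
    Module.Finite F (below (F := F) (fun _ : ι => 1) N) := by
  have hfin (k : ℕ) : (homog (F := F) (fun _ : ι => 1) k).FG := by
    rw [homog_one_eq_component]
    exact Submodule.fg_span (finite_setOf_isCommutator k)
  have h : below (F := F) (fun _ : ι => 1) N = ⨆ k ∈ Finset.range N, homog (fun _ : ι => 1) k := by
    apply le_antisymm
    · intro u hu
      rw [← sum_range_proj hu]
      exact sum_mem fun k hk =>
        Submodule.mem_iSup_of_mem k (Submodule.mem_iSup_of_mem hk (proj_mem _ k u))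
    · exact iSup₂_le fun k hk => homog_le_below (Finset.mem_range.1 hk)
  rw [Module.Finite.iff_fg, h]
  exact Submodule.fg_biSup _ _ fun k _ => hfin k

end Grading

/-! ### Derivations of a free Lie algebra, via dual numbers. -/

section Derivation

variable {F : Type u} [CommRing F] {ι : Type v}

/-- The constant part of an element of `L ⊗ F[ε]`. -/
noncomputable def constPart (L : Type w) [LieRing L] [LieAlgebra F L] :
    DualNumber F ⊗[F] L →ₗ[F] L :=
  TensorProduct.lid F L ∘ₗ TensorProduct.map (TrivSqZeroExt.fstHom F F F).toLinearMap LinearMap.id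

/-- The coefficient of `ε` of an element of `L ⊗ F[ε]`. -/
noncomputable def epsPart (L : Type w) [LieRing L] [LieAlgebra F L] :
    DualNumber F ⊗[F] L →ₗ[F] L :=
  TensorProduct.lid F L ∘ₗ TensorProduct.map (TrivSqZeroExt.sndHom F F) LinearMap.id

section

variable {L : Type w} [LieRing L] [LieAlgebra F L]

theorem constPart_tmul (a : DualNumber F) (x : L) :
    constPart (F := F) L (a ⊗ₜ x) = TrivSqZeroExt.fst a • x := by
  simp [constPart]

theorem epsPart_tmul (a : DualNumber F) (x : L) :
    epsPart (F := F) L (a ⊗ₜ x) = TrivSqZeroExt.snd a • x := by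
  simp [epsPart]

theorem constPart_lie (z w : DualNumber F ⊗[F] L) :
    constPart (F := F) L ⁅z, w⁆ = ⁅constPart L z, constPart L w⁆ := by
  induction z using TensorProduct.induction_on with
  | zero =>
    refine (congrArg _ (zero_lie (L := DualNumber F ⊗[F] L) w)).trans ?_
    simp only [map_zero, zero_lie]
  | add x y hx hy =>
    refine (congrArg _ (add_lie x y w)).trans ?_
    refine (map_add _ _ _).trans ?_
    rw [map_add, add_lie]
    exact congrArg₂ _ hx hy
  | tmul a x =>
    induction w using TensorProduct.induction_on with
    | zero =>
      refine (congrArg _ (lie_zero (a ⊗ₜ[F] x))).trans ?_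
      simp only [map_zero, lie_zero]
    | add y z hy hz =>
      refine (congrArg _ (lie_add (a ⊗ₜ[F] x) y z)).trans ?_
      refine (map_add _ _ _).trans ?_
      rw [map_add, lie_add]
      exact congrArg₂ _ hy hz
    | tmul b y =>
      rw [LieAlgebra.ExtendScalars.bracket_tmul]
      simp only [constPart_tmul, TrivSqZeroExt.fst_mul, smul_lie, lie_smul, smul_smul, mul_comm]

theorem epsPart_lie (z w : DualNumber F ⊗[F] L) :
    epsPart (F := F) L ⁅z, w⁆ = ⁅constPart L z, epsPart L w⁆ + ⁅epsPart L z, constPart L w⁆ := by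
  induction z using TensorProduct.induction_on with
  | zero =>
    refine (congrArg _ (zero_lie (L := DualNumber F ⊗[F] L) w)).trans ?_
    simp only [map_zero, zero_lie, add_zero]
  | add x y hx hy =>
    refine (congrArg _ (add_lie x y w)).trans ?_
    refine (map_add _ _ _).trans ?_
    refine (congrArg₂ _ hx hy).trans ?_
    simp only [map_add, add_lie]
    abel
  | tmul a x =>
    induction w using TensorProduct.induction_on with
    | zero =>
      refine (congrArg _ (lie_zero (a ⊗ₜ[F] x))).trans ?_
      simp only [map_zero, lie_zero, add_zero]
    | add y z hy hz =>
      refine (congrArg _ (lie_add (a ⊗ₜ[F] x) y z)).trans ?_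
      refine (map_add _ _ _).trans ?_
      refine (congrArg₂ _ hy hz).trans ?_
      simp only [map_add, lie_add]
      abel
    | tmul b y =>
      rw [LieAlgebra.ExtendScalars.bracket_tmul]
      simp only [constPart_tmul, epsPart_tmul, TrivSqZeroExt.snd_mul, smul_lie, lie_smul, smul_smul,
        add_smul, smul_eq_mul, MulOpposite.smul_eq_mul_unop, MulOpposite.unop_op, mul_comm]

end

/-- The homomorphism `x ↦ x + ε f(x)` on generators. -/
noncomputable def dualHom (f : ι → FreeLieAlgebra F ι) :
    FreeLieAlgebra F ι →ₗ⁅F⁆ DualNumber F ⊗[F] FreeLieAlgebra F ι :=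
  FreeLieAlgebra.lift F fun i =>
    (1 : DualNumber F) ⊗ₜ FreeLieAlgebra.of F i + DualNumber.eps ⊗ₜ f i

/-- On the image of `dualHom f` the constant parts are the arguments themselves, which turns
`epsPart_lie` into the Leibniz rule for `freeDerivation`. -/
theorem constPart_dualHom (f : ι → FreeLieAlgebra F ι) (u : FreeLieAlgebra F ι) :
    constPart (F := F) _ (dualHom f u) = u := by
  let g : FreeLieAlgebra F ι →ₗ⁅F⁆ FreeLieAlgebra F ι :=
    { constPart (F := F) _ ∘ₗ (dualHom f : FreeLieAlgebra F ι →ₗ[F] _) with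
      map_lie' := fun {x y} => by simp [constPart_lie] }
  have hg : g = LieHom.id := by
    ext i
    change constPart (F := F) _ (dualHom f (FreeLieAlgebra.of F i)) = FreeLieAlgebra.of F i
    simp [dualHom, constPart_tmul]
  exact congrArg (fun h => h u) hg

/-- The derivation of the free Lie algebra with prescribed values on the generators. -/
noncomputable def freeDerivation (f : ι → FreeLieAlgebra F ι) :
    LieDerivation F (FreeLieAlgebra F ι) (FreeLieAlgebra F ι) where
  toLinearMap := epsPart (F := F) _ ∘ₗ (dualHom f : FreeLieAlgebra F ι →ₗ[F] _)
  leibniz' x y := by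
    simp only [LinearMap.comp_apply, LieHom.coe_toLinearMap, LieHom.map_lie, epsPart_lie,
      constPart_dualHom]
    rw [sub_eq_add_neg, lie_skew]

theorem freeDerivation_of (f : ι → FreeLieAlgebra F ι) (i : ι) :
    freeDerivation f (FreeLieAlgebra.of F i) = f i := by
  change epsPart (F := F) _ (dualHom f (FreeLieAlgebra.of F i)) = f i
  simp [dualHom, epsPart_tmul]

end Derivation

/-! ### Lazard elimination. -/

section Elimination

variable {F : Type u} [CommRing F] {ι : Type v}

theorem lift_injective_of_leftInverse {κ : Type v} {L : Type w} [LieRing L] [LieAlgebra F L]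
    (b : κ → L) {M : Type*} [LieRing M] [LieAlgebra F M] (g : L →ₗ⁅F⁆ M)
    (j : FreeLieAlgebra F κ →ₗ⁅F⁆ M) (hj : Function.Injective j)
    (h : ∀ i, g (b i) = j (FreeLieAlgebra.of F i)) :
    Function.Injective (FreeLieAlgebra.lift F b) := by
  have hc : g.comp (FreeLieAlgebra.lift F b) = j := by
    ext i
    simp [h]
  have : Function.Injective (g ∘ FreeLieAlgebra.lift F b) := by
    rw [← LieHom.coe_comp, hc]
    exact hj
  exact this.of_comp

/-- The iterated brackets `(ad z)ᵏ y`, for a generator `z` and the generators `y ≠ z`. -/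
noncomputable def elimGen (L : Type w) [LieRing L] (b : ι → L) (i₀ : ι) :
    ℕ × {i // i ≠ i₀} → L :=
  fun p => (fun x => ⁅b i₀, x⁆)^[p.1] (b p.2)

theorem elimGen_succ {L : Type w} [LieRing L] (b : ι → L) (i₀ : ι) (k : ℕ) (y : {i // i ≠ i₀}) :
    elimGen L b i₀ (k + 1, y) = ⁅b i₀, elimGen L b i₀ (k, y)⁆ :=
  Function.iterate_succ_apply' _ _ _

theorem map_elimGen {L : Type w} [LieRing L] [LieAlgebra F L] {M : Type*} [LieRing M]
    [LieAlgebra F M] (g : L →ₗ⁅F⁆ M) (b : ι → L) (i₀ : ι) (p : ℕ × {i // i ≠ i₀}) :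
    g (elimGen L b i₀ p) = elimGen M (g ∘ b) i₀ p := by
  obtain ⟨k, y⟩ := p
  induction k with
  | zero => rfl
  | succ k ih => rw [elimGen_succ, elimGen_succ, LieHom.map_lie, ih]; rfl

/-- Freeness is detected in the semidirect product of the free algebra `K` on the pairs `(k, y)`
with its derivations. The eliminated generator goes to the shift derivation `(k, y) ↦ (k + 1, y)`
and `y` goes to `(0, y)`, so the iterated bracket $(\mathrm{ad}\,z)^k y$ goes to the free generator
`(k, y)`. -/
theorem lift_elimGen_injective (i₀ : ι) :
    Function.Injective (FreeLieAlgebra.lift F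
      (elimGen (FreeLieAlgebra F ι) (FreeLieAlgebra.of F) i₀)) := by
  classical
  let K := FreeLieAlgebra F (ℕ × {i // i ≠ i₀})
  let δ : LieDerivation F K K := freeDerivation fun p => FreeLieAlgebra.of F (p.1 + 1, p.2)
  let ψ : LieDerivation F K K →ₗ⁅F⁆ LieDerivation F K K := LieHom.id
  let b : ι → LieAlgebra.SemiDirectSum K _ ψ := fun i =>
    if h : i = i₀ then ⟨0, δ⟩ else ⟨FreeLieAlgebra.of F (0, ⟨i, h⟩), 0⟩
  refine lift_injective_of_leftInverse _ (FreeLieAlgebra.lift F b)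
    (LieAlgebra.SemiDirectSum.inl ψ) (LieAlgebra.SemiDirectSum.inl_injective ψ) fun p => ?_
  rw [map_elimGen, FreeLieAlgebra.of_comp_lift]
  obtain ⟨k, y⟩ := p
  induction k with
  | zero => simp [elimGen, b, y.2]
  | succ k ih =>
    rw [elimGen_succ, ih]
    simpa [b, ψ] using freeDerivation_of (fun p : ℕ × {i // i ≠ i₀} =>
      FreeLieAlgebra.of F (p.1 + 1, p.2)) (k, y)

theorem lift_comp_lift {κ : Type*} {L : Type w} [LieRing L] [LieAlgebra F L] (b : ι → L)
    (c : κ → FreeLieAlgebra F ι) :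
    (FreeLieAlgebra.lift F b).comp (FreeLieAlgebra.lift F c) =
      FreeLieAlgebra.lift F (FreeLieAlgebra.lift F b ∘ c) := by
  ext i
  simp

theorem injective_lift_elimGen {L : Type w} [LieRing L] [LieAlgebra F L] {b : ι → L}
    (hb : Function.Injective (FreeLieAlgebra.lift F b)) (i₀ : ι) :
    Function.Injective (FreeLieAlgebra.lift F (elimGen L b i₀)) := by
  have h : elimGen L b i₀ = FreeLieAlgebra.lift F b ∘
      elimGen (FreeLieAlgebra F ι) (FreeLieAlgebra.of F) i₀ := by
    ext p
    rw [Function.comp_apply, map_elimGen, FreeLieAlgebra.of_comp_lift]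
  rw [h, ← lift_comp_lift, LieHom.coe_comp]
  exact hb.comp (lift_elimGen_injective i₀)

/-- Subtracting multiples of one free generator from the others gives free generators. -/
theorem injective_lift_sub_smul {L : Type w} [LieRing L] [LieAlgebra F L] {b : ι → L}
    (hb : Function.Injective (FreeLieAlgebra.lift F b)) (i₀ : ι) {c : ι → F} (hc : c i₀ = 0) :
    Function.Injective (FreeLieAlgebra.lift F fun i => b i - c i • b i₀) := by
  have h : (fun i => b i - c i • b i₀) = FreeLieAlgebra.lift F b ∘
      fun i => FreeLieAlgebra.of F i - c i • FreeLieAlgebra.of F i₀ := by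
    ext i
    simp
  rw [h, ← lift_comp_lift, LieHom.coe_comp]
  refine hb.comp (lift_injective_of_leftInverse _
    (FreeLieAlgebra.lift F fun i => FreeLieAlgebra.of F i + c i • FreeLieAlgebra.of F i₀)
    LieHom.id Function.injective_id fun i => ?_)
  simp [hc]

theorem lieSpan_range_sub_smul {L : Type w} [LieRing L] [LieAlgebra F L] (b : ι → L) (i₀ : ι)
    {c : ι → F} (hc : c i₀ = 0) :
    LieSubalgebra.lieSpan F L (Set.range fun i => b i - c i • b i₀) =
      LieSubalgebra.lieSpan F L (Set.range b) := by
  have h₀ : b i₀ ∈ LieSubalgebra.lieSpan F L (Set.range fun i => b i - c i • b i₀) :=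
    LieSubalgebra.subset_lieSpan ⟨i₀, by simp [hc]⟩
  apply le_antisymm <;> rw [LieSubalgebra.lieSpan_le] <;> rintro _ ⟨i, rfl⟩
  · exact sub_mem (LieSubalgebra.subset_lieSpan ⟨i, rfl⟩)
      (LieSubalgebra.smul_mem _ _ (LieSubalgebra.subset_lieSpan ⟨i₀, rfl⟩))
  · have h : b i - c i • b i₀ ∈ LieSubalgebra.lieSpan F L (Set.range fun i => b i - c i • b i₀) :=
      LieSubalgebra.subset_lieSpan ⟨i, rfl⟩
    simpa using add_mem h (LieSubalgebra.smul_mem _ (c i) h₀)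

/-- In the presence of `b i₀`, the iterated brackets of `b i₀` with the other `b i` generate, modulo
the multiples of `b i₀`, the algebra generated by all the `b i`. -/
theorem exists_sub_smul_mem_range {L : Type w} [LieRing L] [LieAlgebra F L] (b : ι → L) (i₀ : ι)
    (u : FreeLieAlgebra F ι) :
    ∃ a : F, FreeLieAlgebra.lift F b u - a • b i₀ ∈
      (FreeLieAlgebra.lift F (elimGen L b i₀)).range := by
  rw [range_lift]
  set R := LieSubalgebra.lieSpan F L (Set.range (elimGen L b i₀)) with hR
  have hof (p) : elimGen L b i₀ p ∈ R := LieSubalgebra.subset_lieSpan ⟨p, rfl⟩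
  -- The operator `ad (b i₀)` is a derivation that shifts the generators of `R`.
  have had : ∀ x ∈ R, ⁅b i₀, x⁆ ∈ R := by
    intro x hx
    induction hx using LieSubalgebra.lieSpan_induction with
    | mem x hx =>
      obtain ⟨⟨k, y⟩, rfl⟩ := hx
      rw [← elimGen_succ]
      exact hof _
    | zero => simp
    | add x y _ _ hx hy => rw [lie_add]; exact add_mem hx hy
    | smul a x _ hx => rw [lie_smul]; exact R.smul_mem a hx
    | lie x y hx' hy' hx hy =>
      rw [leibniz_lie]
      exact add_mem (R.lie_mem hx hy') (R.lie_mem hx' hy)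
  have hu : FreeLieAlgebra.lift F b u ∈ LieSubalgebra.lieSpan F L (Set.range b) :=
    range_lift (F := F) b ▸ LieHom.mem_range_self _ u
  generalize FreeLieAlgebra.lift F b u = t at hu ⊢
  induction hu using LieSubalgebra.lieSpan_induction with
  | mem x hx =>
    obtain ⟨i, rfl⟩ := hx
    by_cases hi : i = i₀
    · exact ⟨1, by simp [hi]⟩
    · exact ⟨0, by simpa [elimGen] using hof (0, ⟨i, hi⟩)⟩
  | zero => exact ⟨0, by simp⟩
  | add x y _ _ hx hy =>
    obtain ⟨a, ha⟩ := hx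
    obtain ⟨c, hc⟩ := hy
    refine ⟨a + c, ?_⟩
    rw [add_smul, add_sub_add_comm]
    exact add_mem ha hc
  | smul r x _ hx =>
    obtain ⟨a, ha⟩ := hx
    refine ⟨r * a, ?_⟩
    rw [mul_smul, ← smul_sub]
    exact R.smul_mem r ha
  | lie x y _ _ hx hy =>
    obtain ⟨a, ha⟩ := hx
    obtain ⟨c, hc⟩ := hy
    -- Since `b i₀` commutes with itself, every term of the expanded bracket lies in `R`.
    refine ⟨0, ?_⟩
    obtain ⟨x', rfl⟩ : ∃ x', x = x' + a • b i₀ := ⟨x - a • b i₀, by simp⟩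
    obtain ⟨y', rfl⟩ : ∃ y', y = y' + c • b i₀ := ⟨y - c • b i₀, by simp⟩
    rw [add_sub_cancel_right] at ha hc
    have h : ⁅x' + a • b i₀, y' + c • b i₀⁆ = ⁅x', y'⁆ - c • ⁅b i₀, x'⁆ + a • ⁅b i₀, y'⁆ := by
      simp only [add_lie, lie_add, smul_lie, lie_smul, lie_self, smul_zero, add_zero]
      rw [← lie_skew x' (b i₀), smul_neg]
      abel
    rw [zero_smul, sub_zero, h]
    exact add_mem (sub_mem (R.lie_mem ha hc) (R.smul_mem c (had _ ha))) (R.smul_mem a (had _ hc))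

end Elimination

/-! ### Homogeneous free generators of graded subalgebras of finite codimension. -/

section Descent

variable {F : Type u} [Field F] {X : Type v}

/-- `b` is a family of homogeneous free generators of `C`, with `b i` of degree `deg i`. -/
structure IsGradedFree (C : LieSubalgebra F (FreeLieAlgebra F X)) {ι : Type v} (deg : ι → ℕ)
    (b : ι → FreeLieAlgebra F X) : Prop where
  mem_homog : ∀ i, b i ∈ homog (fun _ => 1) (deg i)
  injective : Function.Injective (FreeLieAlgebra.lift F b)
  range_eq : (FreeLieAlgebra.lift F b).range = C

theorem IsGradedFree.lieSpan_eq {C : LieSubalgebra F (FreeLieAlgebra F X)} {ι : Type v}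
    {deg : ι → ℕ} {b : ι → FreeLieAlgebra F X} (h : IsGradedFree C deg b) :
    LieSubalgebra.lieSpan F _ (Set.range b) = C := by
  rw [← range_lift, h.range_eq]

/-- A subalgebra containing the homogeneous components of its elements. -/
def IsGraded (C : LieSubalgebra F (FreeLieAlgebra F X)) : Prop :=
  ∀ u ∈ C, ∀ k, proj (fun _ => 1) k u ∈ C

/-- Homogeneous free generators pass to graded ideals of codimension one. -/
theorem IsGradedFree.exists_of_codim_one {C D : LieSubalgebra F (FreeLieAlgebra F X)} {ι : Type v}
    [Nontrivial ι] {deg : ι → ℕ} {b : ι → FreeLieAlgebra F X} (h : IsGradedFree D deg b)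
    (hC : IsGraded C) (hCD : IsIdealOf C D) {d : ℕ} {z : FreeLieAlgebra F X}
    (hz : z ∈ homog (fun _ => 1) d) (hzD : z ∈ D) (hzC : z ∉ C)
    (hD : ∀ u ∈ D, ∃ a : F, u - a • z ∈ C) :
    ∃ (κ : Type v) (deg' : κ → ℕ) (b' : κ → FreeLieAlgebra F X), IsGradedFree C deg' b' ∧
      Nontrivial κ ∧ ∀ N, ∃ i, N ≤ deg' i := by
  classical
  have hbD (i) : b i ∈ D := h.lieSpan_eq ▸ LieSubalgebra.subset_lieSpan ⟨i, rfl⟩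
  have hd : 1 ≤ d := by
    by_contra hd
    obtain rfl : d = 0 := by omega
    rw [homog_one_zero, Submodule.mem_bot] at hz
    exact hzC (hz ▸ C.zero_mem)
  obtain ⟨i₀, hi₀⟩ : ∃ i, b i ∉ C := by
    by_contra! hcon
    have hle : D ≤ C := by
      rw [← h.lieSpan_eq, LieSubalgebra.lieSpan_le]
      rintro _ ⟨i, rfl⟩
      exact hcon i
    exact hzC (hle hzD)
  -- Modulo `C` everything in `D` is a multiple of `z`; since `C` is graded, a homogeneous element
  -- of another degree lies in `C`.
  have hdeg (i) (hi : b i ∉ C) : deg i = d := by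
    by_contra hne
    obtain ⟨a, ha⟩ := hD _ (hbD i)
    have := hC _ ha (deg i)
    rw [map_sub, map_smul, proj_of_mem (h.mem_homog i), proj_of_mem_of_ne hz hne, smul_zero,
      sub_zero] at this
    exact hi this
  -- The generator `b i₀` can replace `z`, since it too is nonzero in the one-dimensional quotient
  -- `D/C`.
  have hcoef (u) (hu : u ∈ D) : ∃ a : F, u - a • b i₀ ∈ C := by
    obtain ⟨a, ha⟩ := hD u hu
    obtain ⟨a₀, ha₀⟩ := hD _ (hbD i₀)
    have hne : a₀ ≠ 0 := by
      rintro rfl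
      exact hi₀ (by simpa using ha₀)
    refine ⟨a / a₀, ?_⟩
    have := sub_mem ha (C.smul_mem (a / a₀) ha₀)
    rwa [smul_sub, smul_smul, div_mul_cancel₀ _ hne, sub_sub_sub_cancel_right] at this
  choose! e he using hcoef
  -- Only generators outside `C` are corrected; they have the same degree `d` as `b i₀`, so
  -- homogeneity survives.
  let c : ι → F := fun i => if i = i₀ ∨ b i ∈ C then 0 else e (b i)
  have hc₀ : c i₀ = 0 := by simp [c]
  let b' : ι → FreeLieAlgebra F X := fun i => b i - c i • b i₀
  have hb'₀ : b' i₀ = b i₀ := by simp [b', hc₀]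
  have hb'C (i) (hi : i ≠ i₀) : b' i ∈ C := by
    by_cases hbi : b i ∈ C
    · simp [b', c, hbi]
    · simpa [b', c, hbi, hi] using he _ (hbD i)
  have hb'deg (i) : b' i ∈ homog (fun _ => 1) (deg i) := by
    by_cases hi : i = i₀ ∨ b i ∈ C
    · simpa [b', c, hi] using h.mem_homog i
    · refine sub_mem (h.mem_homog i) (Submodule.smul_mem _ _ ?_)
      push Not at hi
      rw [hdeg i hi.2, ← hdeg i₀ hi₀]
      exact h.mem_homog i₀
  have hb'inj : Function.Injective (FreeLieAlgebra.lift F b') :=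
    injective_lift_sub_smul h.injective i₀ hc₀
  have hb'range : (FreeLieAlgebra.lift F b').range = D := by
    rw [range_lift, lieSpan_range_sub_smul b i₀ hc₀, h.lieSpan_eq]
  obtain ⟨y₀, hy₀⟩ := exists_ne i₀
  have hle : (FreeLieAlgebra.lift F (elimGen _ b' i₀)).range ≤ C := by
    rw [range_lift, LieSubalgebra.lieSpan_le]
    rintro _ ⟨⟨k, y⟩, rfl⟩
    induction k with
    | zero => exact hb'C y y.2
    | succ k ih =>
      rw [elimGen_succ, hb'₀]
      exact hCD.2 _ (hbD i₀) _ ih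
  refine ⟨ℕ × {i // i ≠ i₀}, fun p => p.1 * d + deg p.2, elimGen _ b' i₀, ⟨?_, ?_, ?_⟩, ?_, ?_⟩
  · rintro ⟨k, y⟩
    induction k with
    | zero => simpa [elimGen] using hb'deg y
    | succ k ih =>
      rw [elimGen_succ]
      have h0 := hb'deg i₀
      rw [hdeg i₀ hi₀] at h0
      have := lie_mem_homog h0 ih
      rwa [show d + (k * d + deg y) = (k + 1) * d + deg y by ring] at this
  · exact injective_lift_elimGen hb'inj i₀
  · refine le_antisymm hle fun x hx => ?_
    obtain ⟨u, rfl⟩ : x ∈ (FreeLieAlgebra.lift F b').range := hb'range ▸ hCD.1 hx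
    obtain ⟨a, ha⟩ := exists_sub_smul_mem_range (F := F) b' i₀ u
    replace hx : FreeLieAlgebra.lift F b' u ∈ C := hx
    -- The eliminated subalgebra lies in `C` and misses only multiples of `b i₀`, none of which but
    -- zero is in `C`.
    have h1 : a • b i₀ ∈ C := by
      have := sub_mem hx (hle ha)
      rwa [sub_sub_cancel, hb'₀] at this
    have h2 : a = 0 := by
      by_contra hne
      exact hi₀ (by simpa [smul_smul, inv_mul_cancel₀ hne] using C.smul_mem a⁻¹ h1)
    simpa [h2] using ha
  · have : Nonempty {i // i ≠ i₀} := ⟨⟨y₀, hy₀⟩⟩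
    infer_instance
  · intro N
    refine ⟨(N, ⟨y₀, hy₀⟩), ?_⟩
    simp only
    nlinarith

/-- A proper graded subalgebra of finite codimension is an ideal of codimension one in a larger
graded subalgebra. -/
theorem exists_codim_one_extension {C : LieSubalgebra F (FreeLieAlgebra F X)} (hC : IsGraded C)
    (hne : C ≠ ⊤) {n : ℕ} (hn : ∀ k, n ≤ k → homog (fun _ => 1) k ≤ C.toSubmodule) :
    ∃ (D : LieSubalgebra F (FreeLieAlgebra F X)) (d : ℕ) (z : FreeLieAlgebra F X),
      IsGraded D ∧ IsIdealOf C D ∧ z ∈ homog (fun _ => 1) d ∧ z ∈ D ∧ z ∉ C ∧ d < n ∧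
      ∀ u ∈ D, ∃ a : F, u - a • z ∈ C := by
  classical
  -- Take the largest degree in which `C` is not everything: bracketing with `z` in that degree
  -- raises positive degrees above `d`, hence lands in `C`.
  obtain ⟨d, hd, hmax⟩ : ∃ d, (¬ homog (fun _ => 1) d ≤ C.toSubmodule) ∧
      ∀ k, d < k → homog (fun _ => 1) k ≤ C.toSubmodule := by
    obtain ⟨m, hm⟩ : ∃ m, ¬ homog (fun _ => 1) m ≤ C.toSubmodule := by
      by_contra! hcon
      exact hne (eq_top_iff.2 fun u _ =>
        mem_of_forall_proj_mem (S := C.toSubmodule) fun k => hcon k (proj_mem (fun _ => 1) k u))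
    have hmn : m ≤ n := by
      by_contra h
      exact hm (hn m (by omega))
    refine ⟨Nat.findGreatest (fun m => ¬ homog (fun _ => 1) m ≤ C.toSubmodule) n,
      Nat.findGreatest_spec (P := fun m => ¬ homog (fun _ => 1) m ≤ C.toSubmodule) hmn hm,
      fun k hk => ?_⟩
    by_cases hkn : k ≤ n
    · exact not_not.1 (Nat.findGreatest_is_greatest hk hkn)
    · exact hn k (by omega)
  obtain ⟨z, hz, hzC⟩ := SetLike.not_le_iff_exists.1 hd
  have hzC : z ∉ C := hzC
  have hdn : d < n := by
    by_contra h
    exact hd (hn d (by omega))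
  have hlie : ∀ x ∈ C, ⁅z, x⁆ ∈ C := by
    intro x hx
    refine mem_of_forall_proj_mem (d := fun _ => 1) (S := C.toSubmodule) fun k =>
      proj_lie_mem fun i j hij => ?_
    by_cases hi : i = d
    · subst hi
      by_cases hj : j = 0
      · have := proj_mem (fun _ => 1) j x
        rw [hj, homog_one_zero, Submodule.mem_bot] at this
        rw [hj, this, lie_zero]
        exact zero_mem _
      · exact hmax (i + j) (by omega) (lie_mem_homog (proj_mem _ i z) (proj_mem _ j x))
    · rw [proj_of_mem_of_ne hz hi, zero_lie]
      exact zero_mem _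
  let D : LieSubalgebra F (FreeLieAlgebra F X) :=
    { carrier := {u | ∃ a : F, u - a • z ∈ C}
      zero_mem' := ⟨0, by simp⟩
      add_mem' := by
        rintro x y ⟨a, ha⟩ ⟨c, hc⟩
        refine ⟨a + c, ?_⟩
        rw [add_smul, add_sub_add_comm]
        exact add_mem ha hc
      smul_mem' := by
        rintro r x ⟨a, ha⟩
        refine ⟨r * a, ?_⟩
        rw [mul_smul, ← smul_sub]
        exact C.smul_mem r ha
      lie_mem' := by
        rintro x y ⟨a, ha⟩ ⟨c, hc⟩
        refine ⟨0, ?_⟩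
        have h : ⁅x, y⁆ - (0 : F) • z =
            ⁅x - a • z, y - c • z⁆ + a • ⁅z, y - c • z⁆ - c • ⁅z, x - a • z⁆ := by
          simp only [sub_lie, lie_sub, smul_lie, lie_smul, lie_self, smul_zero, zero_smul, sub_zero]
          rw [← lie_skew x z, smul_neg]
          abel
        rw [h]
        exact sub_mem (add_mem (C.lie_mem ha hc) (C.smul_mem a (hlie _ hc)))
          (C.smul_mem c (hlie _ ha)) }
  refine ⟨D, d, z, ?_, ⟨fun x hx => ⟨0, by simpa using hx⟩, ?_⟩, hz, ⟨1, by simp⟩, hzC, hdn,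
    fun u hu => hu⟩
  · rintro u ⟨a, ha⟩ k
    have h := hC _ ha k
    rw [map_sub, map_smul] at h
    by_cases hk : k = d
    · subst hk
      rw [proj_of_mem hz] at h
      exact ⟨a, h⟩
    · rw [proj_of_mem_of_ne hz hk, smul_zero] at h
      exact ⟨0, by simpa using h⟩
  · rintro x ⟨a, ha⟩ y hy
    have h : ⁅x, y⁆ = ⁅x - a • z, y⁆ + a • ⁅z, y⁆ := by
      simp only [sub_lie, smul_lie, sub_add_cancel]
    rw [h]
    exact add_mem (C.lie_mem ha hy) (C.smul_mem a (hlie y hy))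

/-- Induction on the codimension of `C` within degrees below `n`, which is finite because `X` is.
`Nontrivial κ` is carried along because elimination needs a second generator `y` to produce the
$(\mathrm{ad}\,z)^k y$ of unbounded degree. -/
theorem exists_isGradedFree [Finite X] [Nontrivial X] {C : LieSubalgebra F (FreeLieAlgebra F X)}
    (hC : IsGraded C) {n : ℕ} (hn : ∀ k, n ≤ k → homog (fun _ => 1) k ≤ C.toSubmodule) :
    ∃ (κ : Type v) (deg : κ → ℕ) (b : κ → FreeLieAlgebra F X), IsGradedFree C deg b ∧
      Nontrivial κ ∧ (C ≠ ⊤ → ∀ N, ∃ i, N ≤ deg i) := by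
  have := finite_below (F := F) (ι := X) n
  obtain ⟨m, hm⟩ : ∃ m, Module.finrank F (below (F := F) (fun _ : X => 1) n) -
      Module.finrank F ↥(C.toSubmodule ⊓ below (F := F) (fun _ : X => 1) n) = m := ⟨_, rfl⟩
  induction m using Nat.strong_induction_on generalizing C with
  | _ m ih =>
    by_cases hne : C = ⊤
    · refine ⟨X, fun _ => 1, FreeLieAlgebra.of F, ⟨of_mem_homog _, ?_, ?_⟩, inferInstance,
        fun h => absurd hne h⟩
      · rw [show FreeLieAlgebra.lift F (FreeLieAlgebra.of F : X → _) = LieHom.id by ext; simp]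
        exact Function.injective_id
      · rw [hne]
        exact eq_top_of_forall_of_mem _ fun i => ⟨FreeLieAlgebra.of F i, by simp⟩
    · obtain ⟨D, d, z, hD, hCD, hz, hzD, hzC, hdn, hcod⟩ := exists_codim_one_extension hC hne hn
      have hlt : Module.finrank F ↥(C.toSubmodule ⊓ below (F := F) (fun _ : X => 1) n) <
          Module.finrank F ↥(D.toSubmodule ⊓ below (F := F) (fun _ : X => 1) n) := by
        have : Module.Finite F ↥(D.toSubmodule ⊓ below (F := F) (fun _ : X => 1) n) :=
          Submodule.finiteDimensional_inf_right _ _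
        refine Submodule.finrank_lt_finrank_of_lt (lt_of_le_of_ne ?_ ?_)
        · exact inf_le_inf_right _ hCD.1
        · intro heq
          have : z ∈ D.toSubmodule ⊓ below (F := F) (fun _ : X => 1) n :=
            ⟨hzD, homog_le_below hdn hz⟩
          rw [← heq] at this
          exact hzC this.1
      have hle : Module.finrank F ↥(D.toSubmodule ⊓ below (F := F) (fun _ : X => 1) n) ≤
          Module.finrank F (below (F := F) (fun _ : X => 1) n) :=
        Submodule.finrank_mono inf_le_right
      obtain ⟨κ, deg, b, hb, hκ, -⟩ := ih _ (by omega) hD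
        (fun k hk => (hn k hk).trans hCD.1) rfl
      obtain ⟨κ', deg', b', hb', hκ', hN⟩ := hb.exists_of_codim_one hC hCD hz hzD hzC hcod
      exact ⟨κ', deg', b', hb', hκ', fun _ => hN⟩

end Descent

/-! ### Free products from partitions of free generators. -/

section FreeFactor

variable {F : Type u} [CommRing F]

theorem lieHom_ext_lieSpan {L : Type*} [LieRing L] [LieAlgebra F L] {M : Type*} [LieRing M]
    [LieAlgebra F M] {s : Set L} {f g : LieSubalgebra.lieSpan F L s →ₗ⁅F⁆ M}
    (h : ∀ x (hx : x ∈ s), f ⟨x, LieSubalgebra.subset_lieSpan hx⟩ =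
      g ⟨x, LieSubalgebra.subset_lieSpan hx⟩) : f = g := by
  ext ⟨x, hx⟩
  induction hx using LieSubalgebra.lieSpan_induction with
  | mem x hx => exact h x hx
  | zero => exact (map_zero f).trans (map_zero g).symm
  | add x y hx hy h1 h2 =>
    exact (map_add f ⟨x, hx⟩ ⟨y, hy⟩).trans
      ((congrArg₂ _ h1 h2).trans (map_add g ⟨x, hx⟩ ⟨y, hy⟩).symm)
  | smul a x hx h1 =>
    exact (map_smul f a ⟨x, hx⟩).trans ((congrArg _ h1).trans (map_smul g a ⟨x, hx⟩).symm)
  | lie x y hx hy h1 h2 =>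
    exact (LieHom.map_lie f ⟨x, hx⟩ ⟨y, hy⟩).trans
      ((congrArg₂ _ h1 h2).trans (LieHom.map_lie g ⟨x, hx⟩ ⟨y, hy⟩).symm)

/-- A partition of a family of free generators gives a free product decomposition. -/
theorem isFreeProduct_of_injective_lift {κ : Type v} {L : Type w} [LieRing L] [LieAlgebra F L]
    {h : κ → L} (hinj : Function.Injective (FreeLieAlgebra.lift F h)) (S : Set κ) :
    IsFreeProduct (LieSubalgebra.lieSpan F L (h '' S)) (LieSubalgebra.lieSpan F L (h '' Sᶜ))
      (FreeLieAlgebra.lift F h).range := by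
  classical
  have hle (T : Set κ) : LieSubalgebra.lieSpan F L (h '' T) ≤ (FreeLieAlgebra.lift F h).range := by
    rw [range_lift]
    exact LieSubalgebra.lieSpan_mono (Set.image_subset_range h T)
  refine ⟨hle S, hle Sᶜ, fun M _ _ f g => ?_⟩
  let e := LieEquiv.ofInjective (FreeLieAlgebra.lift F h) hinj
  have he (i : κ) (hi : h i ∈ (FreeLieAlgebra.lift F h).range) :
      (⟨h i, hi⟩ : (FreeLieAlgebra.lift F h).range) = e (FreeLieAlgebra.of F i) := by
    ext
    simp [e]
  let q : κ → M := fun i =>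
    if hi : i ∈ S then f ⟨h i, LieSubalgebra.subset_lieSpan ⟨i, hi, rfl⟩⟩
    else g ⟨h i, LieSubalgebra.subset_lieSpan ⟨i, hi, rfl⟩⟩
  refine ⟨(FreeLieAlgebra.lift F q).comp e.symm.toLieHom, ⟨?_, ?_⟩, ?_⟩
  · refine lieHom_ext_lieSpan ?_
    rintro _ ⟨i, hi, rfl⟩
    rw [LieHom.comp_apply, LieHom.comp_apply, LieSubalgebra.inclusion_apply, he]
    simp [q, hi]
  · refine lieHom_ext_lieSpan ?_
    rintro _ ⟨i, hi, rfl⟩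
    rw [LieHom.comp_apply, LieHom.comp_apply, LieSubalgebra.inclusion_apply, he]
    have hi' : i ∉ S := hi
    simp [q, hi']
  · rintro r ⟨rfl, rfl⟩
    have hr : r.comp e.toLieHom = FreeLieAlgebra.lift F q := by
      ext i
      rw [FreeLieAlgebra.lift_of_apply]
      by_cases hi : i ∈ S
      · rw [show q i = _ from dif_pos hi, LieHom.comp_apply, LieHom.comp_apply,
          LieSubalgebra.inclusion_apply, he]
        rfl
      · rw [show q i = _ from dif_neg hi, LieHom.comp_apply, LieHom.comp_apply,
          LieSubalgebra.inclusion_apply, he]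
        rfl
    rw [← hr]
    ext x
    simp

/-- The coordinate of the generator `i`, a homomorphism to the abelian Lie algebra `F`, kills the
generators in `S` but not `i`. -/
theorem of_notMem_lieSpan [Nontrivial F] {κ : Type v} {S : Set κ} {i : κ} (hi : i ∉ S) :
    FreeLieAlgebra.of F i ∉ LieSubalgebra.lieSpan F _ (FreeLieAlgebra.of F '' S) := by
  classical
  let : LieRing F := LieRing.ofAssociativeRing
  let : LieAlgebra F F := LieAlgebra.ofAssociativeAlgebra
  let f : FreeLieAlgebra F κ →ₗ⁅F⁆ F := FreeLieAlgebra.lift F fun j => if j = i then 1 else 0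
  intro hmem
  have hle : LieSubalgebra.lieSpan F _ (FreeLieAlgebra.of F '' S) ≤
      (⊥ : LieSubalgebra F F).comap f := by
    rw [LieSubalgebra.lieSpan_le]
    rintro _ ⟨j, hj, rfl⟩
    have : j ≠ i := fun h => hi (h ▸ hj)
    simp [f, this]
  have := hle hmem
  simp [f] at this

end FreeFactor

/-! ### Perturbing homogeneous free generators by terms of lower degree. -/

section LeadingTerms

variable {F : Type u} [Field F] {X κ : Type v} {deg : κ → ℕ} {b h : κ → FreeLieAlgebra F X}

theorem lift_mem_homog (hb : ∀ i, b i ∈ homog (fun _ => 1) (deg i)) {k : ℕ}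
    {p : FreeLieAlgebra F κ} (hp : p ∈ homog deg k) :
    FreeLieAlgebra.lift F b p ∈ homog (fun _ => 1) k := by
  refine homog_le_of_graded (d := deg) (fun k => (homog (fun _ : X => 1) k).comap
    (FreeLieAlgebra.lift F b : FreeLieAlgebra F κ →ₗ[F] FreeLieAlgebra F X)) (fun i => by simpa using hb i)
    (fun k l u hu v hv _ _ => ?_) k hp
  simp only [Submodule.mem_comap, LieHom.coe_toLinearMap, LieHom.map_lie] at *
  exact lie_mem_homog hu hv

/-- When the generators `i` carry the weights `deg i`, `lift b` is a graded map. -/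
theorem proj_lift (hb : ∀ i, b i ∈ homog (fun _ => 1) (deg i)) (k : ℕ) (p : FreeLieAlgebra F κ) :
    proj (fun _ => 1) k (FreeLieAlgebra.lift F b p) = FreeLieAlgebra.lift F b (proj deg k p) := by
  obtain ⟨N, hN⟩ := exists_mem_below deg p
  conv_lhs => rw [← sum_range_proj hN]
  rw [map_sum, map_sum]
  have (j : ℕ) : proj (fun _ => 1) k (FreeLieAlgebra.lift F b (proj deg j p)) =
      if k = j then FreeLieAlgebra.lift F b (proj deg k p) else 0 := by
    have hj := lift_mem_homog hb (proj_mem deg j p)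
    split_ifs with hk
    · subst hk
      exact proj_of_mem hj
    · exact proj_of_mem_of_ne hj hk
  simp only [this, Finset.sum_ite_eq, Finset.mem_range]
  split_ifs with hk
  · rfl
  · rw [mem_below.1 hN k (by omega), map_zero]

/-- Perturbing the generators by terms of lower degree does not change leading terms. -/
theorem lift_sub_lift_mem_below (hb : ∀ i, b i ∈ homog (fun _ => 1) (deg i))
    (hh : ∀ i, h i - b i ∈ below (fun _ => 1) (deg i)) {k : ℕ} {p : FreeLieAlgebra F κ}
    (hp : p ∈ homog deg k) :
    FreeLieAlgebra.lift F h p - FreeLieAlgebra.lift F b p ∈ below (fun _ => 1) k := by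
  refine homog_le_of_graded (d := deg) (fun k => (below (fun _ : X => 1) k).comap
    ((FreeLieAlgebra.lift F h : FreeLieAlgebra F κ →ₗ[F] FreeLieAlgebra F X) -
      (FreeLieAlgebra.lift F b : FreeLieAlgebra F κ →ₗ[F] FreeLieAlgebra F X)))
    (fun i => by simpa using hh i)
    (fun k l u hu v hv hu' hv' => ?_) k hp
  simp only [Submodule.mem_comap, LinearMap.sub_apply, LieHom.coe_toLinearMap, LieHom.map_lie] at *
  have hbu := homog_le_below k.lt_succ_self (lift_mem_homog hb hu')
  have hbv := homog_le_below l.lt_succ_self (lift_mem_homog hb hv')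
  set x := FreeLieAlgebra.lift F h u
  set y := FreeLieAlgebra.lift F h v
  set x' := FreeLieAlgebra.lift F b u
  set y' := FreeLieAlgebra.lift F b v
  have hy : y ∈ below (fun _ => 1) (l + 1) := by
    simpa using add_mem (below_mono l.le_succ hv) hbv
  -- Each term on the right has an error of lower degree as one of its factors.
  have heq : ⁅x, y⁆ - ⁅x', y'⁆ = ⁅x - x', y⁆ - ⁅y - y', x'⁆ := by
    rw [← lie_skew (y - y') x', sub_lie, lie_sub]
    abel
  rw [heq]
  refine sub_mem (lie_mem_below hu hy) ?_
  rw [add_comm]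
  exact lie_mem_below hv hbu

theorem lift_mem_below (hb : ∀ i, b i ∈ homog (fun _ => 1) (deg i))
    (hh : ∀ i, h i - b i ∈ below (fun _ => 1) (deg i)) {k : ℕ} {p : FreeLieAlgebra F κ}
    (hp : p ∈ homog deg k) : FreeLieAlgebra.lift F h p ∈ below (fun _ => 1) (k + 1) := by
  simpa using add_mem (below_mono k.le_succ (lift_sub_lift_mem_below hb hh hp))
    (homog_le_below k.lt_succ_self (lift_mem_homog hb hp))

/-- Elements with free leading terms are free generators. -/
theorem injective_lift_of_leading (hb : ∀ i, b i ∈ homog (fun _ => 1) (deg i))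
    (hinj : Function.Injective (FreeLieAlgebra.lift F b))
    (hh : ∀ i, h i - b i ∈ below (fun _ => 1) (deg i)) :
    Function.Injective (FreeLieAlgebra.lift F h) := by
  have key (N : ℕ) : ∀ p ∈ below deg N, FreeLieAlgebra.lift F h p = 0 → p = 0 := by
    induction N with
    | zero =>
      intro p hp _
      rwa [below_zero, Submodule.mem_bot] at hp
    | succ N ih =>
      intro p hp h0
      refine ih p (mem_below_of_proj_eq_zero hp ?_) h0
      have hq := proj_mem deg N p
      have hlow : FreeLieAlgebra.lift F h (p - proj deg N p) ∈ below (fun _ => 1) N := by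
        rw [← sum_range_proj (sub_proj_mem_below hp), map_sum]
        exact sum_mem fun k hk => below_mono (Finset.mem_range.1 hk)
          (lift_mem_below hb hh (proj_mem deg k _))
      -- In a relation among the `h i`, the top component yields a relation among the `b i` up to
      -- lower degree; being homogeneous of degree `N`, its value is zero.
      have hz : FreeLieAlgebra.lift F b (proj deg N p) ∈ below (fun _ => 1) N := by
        have := sub_mem (neg_mem hlow) (lift_sub_lift_mem_below hb hh hq)
        rw [map_sub, h0] at this
        simpa using this
      have := mem_below.1 hz N le_rfl
      rw [proj_of_mem (lift_mem_homog hb hq)] at this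
      exact hinj (this.trans (map_zero _).symm)
  rw [injective_iff_map_eq_zero]
  intro p hp
  obtain ⟨N, hN⟩ := exists_mem_below deg p
  exact key N p hN hp

theorem homog_le_lieSpan (k : ℕ) :
    homog (F := F) deg k ≤
      (LieSubalgebra.lieSpan F _ (FreeLieAlgebra.of F '' {i | deg i ≤ k})).toSubmodule := by
  refine homog_le_of_graded (d := deg) (fun k =>
    (LieSubalgebra.lieSpan F _ (FreeLieAlgebra.of F '' {i | deg i ≤ k})).toSubmodule) (fun i => ?_)
    (fun k l u hu v hv _ _ => ?_) k
  · exact LieSubalgebra.subset_lieSpan ⟨i, le_refl (deg i), rfl⟩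
  · refine LieSubalgebra.lie_mem _ (LieSubalgebra.lieSpan_mono ?_ hu)
      (LieSubalgebra.lieSpan_mono ?_ hv)
    · exact Set.image_mono fun i (hi : deg i ≤ k) => (show deg i ≤ k + l by omega)
    · exact Set.image_mono fun i (hi : deg i ≤ l) => (show deg i ≤ k + l by omega)

/-- If the leading terms of the elements of `H` of degree less than `n` lie in `C`, then these
elements are generated by elements of `H` lifting the free generators of `C`. -/
theorem mem_lieSpan_of_mem_below {C H : LieSubalgebra F (FreeLieAlgebra F X)}
    (hC : IsGradedFree C deg b) (hh : ∀ i, h i - b i ∈ below (fun _ => 1) (deg i)) {n : ℕ}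
    (hH : ∀ i, deg i < n → h i ∈ H)
    (hlead : ∀ k < n, ∀ u ∈ H, u ∈ below (fun _ => 1) (k + 1) → proj (fun _ => 1) k u ∈ C)
    {k : ℕ} (hk : k ≤ n) {u : FreeLieAlgebra F X} (hu : u ∈ H) (huk : u ∈ below (fun _ => 1) k) :
    u ∈ LieSubalgebra.lieSpan F _ (h '' {i | deg i < n}) := by
  induction k generalizing u with
  | zero =>
    rw [below_zero, Submodule.mem_bot] at huk
    rw [huk]
    exact zero_mem _
  | succ k ih =>
    have hle : LieSubalgebra.lieSpan F _ (h '' {i | deg i < n}) ≤ H := by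
      rw [LieSubalgebra.lieSpan_le]
      rintro _ ⟨i, hi, rfl⟩
      exact hH i hi
    have hlC := hlead k hk u hu huk
    rw [← hC.range_eq] at hlC
    obtain ⟨p, hp⟩ := hlC
    have hq := proj_mem deg k p
    have hbq : FreeLieAlgebra.lift F b (proj deg k p) = proj (fun _ => 1) k u := by
      rw [← proj_lift hC.mem_homog, show FreeLieAlgebra.lift F b p = _ from hp, proj_proj,
        if_pos rfl]
    -- An element of weight `k` involves only generators of degree at most `k < n`, whose lifts lie
    -- in `H`.
    have hmem : FreeLieAlgebra.lift F h (proj deg k p) ∈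
        LieSubalgebra.lieSpan F _ (h '' {i | deg i < n}) := by
      have hcomap : LieSubalgebra.lieSpan F _ (FreeLieAlgebra.of F '' {i | deg i ≤ k}) ≤
          (LieSubalgebra.lieSpan F _ (h '' {i | deg i < n})).comap (FreeLieAlgebra.lift F h) := by
        rw [LieSubalgebra.lieSpan_le]
        rintro _ ⟨i, hi, rfl⟩
        have hi : deg i ≤ k := hi
        simpa using LieSubalgebra.subset_lieSpan
          (show h i ∈ h '' {i | deg i < n} from ⟨i, show deg i < n by omega, rfl⟩)
      exact hcomap (homog_le_lieSpan k hq)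
    -- Subtracting an element of `H` with the same leading term lowers the degree.
    have hrest := ih (by omega) (sub_mem hu (hle hmem)) <| by
      refine mem_below_of_proj_eq_zero (sub_mem huk (lift_mem_below hC.mem_homog hh hq)) ?_
      have := mem_below.1 (lift_sub_lift_mem_below hC.mem_homog hh hq) k le_rfl
      rw [map_sub, hbq, proj_proj, if_pos rfl] at this
      rw [map_sub, sub_eq_zero]
      exact (sub_eq_zero.1 this).symm
    simpa using add_mem hrest hmem

end LeadingTerms

/-! ### The chain of truncated leading-term algebras, and free factors from lifts. -/

section Truncation

variable {F : Type u} [Field F] {X : Type v}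

/-- The leading terms of degree `k` of the elements of `H`. -/
noncomputable def leading (H : LieSubalgebra F (FreeLieAlgebra F X)) (k : ℕ) :
    Submodule F (FreeLieAlgebra F X) :=
  (H.toSubmodule ⊓ below (fun _ => 1) (k + 1)).map (proj (fun _ => 1) k)

variable {H : LieSubalgebra F (FreeLieAlgebra F X)}

/-- The component of degree `i + j` of a bracket is the bracket of the top components. It may
vanish, which is harmless because `leading` contains zero. -/
theorem lie_mem_leading {i j : ℕ} {x y : FreeLieAlgebra F X} (hx : x ∈ leading H i)
    (hy : y ∈ leading H j) : ⁅x, y⁆ ∈ leading H (i + j) := by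
  obtain ⟨u, ⟨huH, hu⟩, rfl⟩ := hx
  obtain ⟨v, ⟨hvH, hv⟩, rfl⟩ := hy
  refine ⟨⁅u, v⁆, ⟨H.lie_mem huH hvH, ?_⟩, ?_⟩
  · have := lie_mem_below hu hv
    rwa [add_right_comm] at this
  · have h1 := lie_mem_below (sub_proj_mem_below hu) hv
    have h2 := lie_mem_below (sub_proj_mem_below hv)
      (homog_le_below i.lt_succ_self (proj_mem (fun _ => 1) i u))
    rw [add_comm] at h2
    have heq : ⁅u, v⁆ = ⁅proj (fun _ => 1) i u, proj (fun _ => 1) j v⁆ +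
        (⁅u - proj (fun _ => 1) i u, v⁆ -
          ⁅v - proj (fun _ => 1) j v, proj (fun _ => 1) i u⁆) := by
      rw [← lie_skew (v - proj (fun _ => 1) j v), sub_lie, lie_sub]
      abel
    rw [heq, map_add, mem_below.1 (sub_mem h1 h2) _ le_rfl, add_zero,
      proj_of_mem (lie_mem_homog (proj_mem _ i u) (proj_mem _ j v))]

/-- The graded subalgebra of the elements whose components of degree less than `n` are leading
terms of elements of `H`. -/
noncomputable def truncation (H : LieSubalgebra F (FreeLieAlgebra F X)) (n : ℕ) :
    LieSubalgebra F (FreeLieAlgebra F X) where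
  carrier := {u | ∀ k < n, proj (fun _ => 1) k u ∈ leading H k}
  zero_mem' k _ := by simp
  add_mem' hu hv k hk := by
    rw [map_add]
    exact add_mem (hu k hk) (hv k hk)
  smul_mem' a u hu k hk := by
    rw [map_smul]
    exact Submodule.smul_mem _ a (hu k hk)
  lie_mem' {u v} hu hv k hk := by
    refine proj_lie_mem fun i j hij => ?_
    subst hij
    exact lie_mem_leading (hu i (by omega)) (hv j (by omega))

theorem mem_truncation {n : ℕ} {u : FreeLieAlgebra F X} :
    u ∈ truncation H n ↔ ∀ k < n, proj (fun _ => 1) k u ∈ leading H k := Iff.rfl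

theorem isGraded_truncation (H : LieSubalgebra F (FreeLieAlgebra F X)) (n : ℕ) :
    IsGraded (truncation H n) := by
  intro u hu k j hj
  rw [proj_proj]
  split_ifs with h
  · subst h
    exact hu j hj
  · exact zero_mem _

theorem homog_le_truncation {n k : ℕ} (hk : n ≤ k) :
    homog (fun _ => 1) k ≤ (truncation H n).toSubmodule := by
  intro u hu j hj
  rw [proj_of_mem_of_ne hu (by omega)]
  exact zero_mem _

/-- There is nothing in degree 0, so in a component of degree at most `n` of a bracket the factor
from the larger algebra has degree less than `n`, where its components are leading terms. -/
theorem isIdealOf_truncation_succ (H : LieSubalgebra F (FreeLieAlgebra F X)) (n : ℕ) :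
    IsIdealOf (truncation H (n + 1)) (truncation H n) := by
  refine ⟨fun u hu k hk => hu k (by omega), fun u hu v hv k hk => proj_lie_mem fun i j hij => ?_⟩
  by_cases hj : j = 0
  · have := proj_mem (fun _ => 1) j v
    rw [hj, homog_one_zero, Submodule.mem_bot] at this
    rw [hj, this, lie_zero]
    exact zero_mem _
  · subst hij
    exact lie_mem_leading (hu i (by omega)) (hv j (by omega))

theorem truncation_zero (H : LieSubalgebra F (FreeLieAlgebra F X)) : truncation H 0 = ⊤ :=
  eq_top_iff.2 fun _ _ k hk => absurd hk (by omega)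

theorem isSubideal_truncation (H : LieSubalgebra F (FreeLieAlgebra F X)) {n : ℕ} (hn : 1 ≤ n) :
    IsSubideal (truncation H n) :=
  ⟨n, hn, truncation H, truncation_zero H, rfl, fun i _ => isIdealOf_truncation_succ H i⟩

/-- Otherwise every homogeneous element is a leading term of an element of `H`, and removing leading
terms one degree at a time gives `H = ⊤`. -/
theorem exists_truncation_ne_top (hH : H ≠ ⊤) : ∃ n, ∀ m, n ≤ m → truncation H m ≠ ⊤ := by
  by_contra! hcon
  have hlead (k : ℕ) : homog (fun _ => 1) k ≤ leading H k := by
    obtain ⟨m, hm, htop⟩ := hcon (k + 1)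
    intro u hu
    have := mem_truncation.1 (htop ▸ LieSubalgebra.mem_top u : u ∈ truncation H m) k (by omega)
    rwa [proj_of_mem hu] at this
  have hle (N : ℕ) : below (fun _ => 1) N ≤ H.toSubmodule := by
    induction N with
    | zero => rw [below_zero]; exact bot_le
    | succ N ih =>
      intro u hu
      obtain ⟨x, ⟨hxH, hx⟩, hxu⟩ := hlead N (proj_mem (fun _ => 1) N u)
      have : u - x ∈ below (fun _ => 1) N :=
        mem_below_of_proj_eq_zero (sub_mem hu hx) (by rw [map_sub, hxu, sub_self])
      simpa using add_mem (ih this) hxH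
  refine hH (eq_top_iff.2 fun u _ => ?_)
  obtain ⟨N, hN⟩ := exists_mem_below (fun _ => 1) u
  exact hle N hN

/-- The degrees of finitely many generators are bounded; finite generation enters only here. -/
theorem exists_generators_mem_below (hfg : IsFG H) : ∃ n, ∀ m, n ≤ m →
    H ≤ LieSubalgebra.lieSpan F _ {u | u ∈ H ∧ u ∈ below (fun _ => 1) m} := by
  obtain ⟨s, rfl⟩ := hfg
  choose N hN using fun u : FreeLieAlgebra F X => exists_mem_below (fun _ => 1) u
  refine ⟨s.sup N, fun m hm => LieSubalgebra.lieSpan_le.2 fun u hu =>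
    LieSubalgebra.subset_lieSpan ⟨LieSubalgebra.subset_lieSpan hu, ?_⟩⟩
  exact below_mono ((Finset.le_sup hu).trans hm) (hN u)

theorem IsHomogeneous.isGraded (hH : IsHomogeneous H) : IsGraded H := by
  intro u hu
  refine hH (components (fun _ => 1) u) (fun n => ?_) ?_
  · rw [← homog_one_eq_component]
    exact proj_mem (fun _ => 1) n u
  · rwa [sum_components]

/-- A perturbation, by elements of `H`, of homogeneous free generators of a truncation of `H`
exhibits `H` as a proper free factor. -/
theorem isFreeFactor_of_lifts {n : ℕ}
    (hgen : H ≤ LieSubalgebra.lieSpan F _ {u | u ∈ H ∧ u ∈ below (fun _ => 1) n})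
    {κ : Type v} {deg : κ → ℕ} {b h : κ → FreeLieAlgebra F X}
    (hb : IsGradedFree (truncation H n) deg b) (hlarge : ∃ i, n ≤ deg i)
    (hh : ∀ i, h i - b i ∈ below (fun _ => 1) (deg i)) (hH : ∀ i, deg i < n → h i ∈ H) :
    H < (FreeLieAlgebra.lift F h).range ∧ IsFreeFactor H (FreeLieAlgebra.lift F h).range := by
  have hinj := injective_lift_of_leading hb.mem_homog hb.injective hh
  have hspan : LieSubalgebra.lieSpan F _ (h '' {i | deg i < n}) = H := by
    apply le_antisymm
    · rw [LieSubalgebra.lieSpan_le]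
      rintro _ ⟨i, hi, rfl⟩
      exact hH i hi
    · refine hgen.trans (LieSubalgebra.lieSpan_le.2 fun u hu => ?_)
      refine mem_lieSpan_of_mem_below hb hh hH (fun k hk x hxH hx j hj => ?_) le_rfl hu.1 hu.2
      rw [proj_proj]
      split_ifs with hjk
      · subst hjk
        exact ⟨x, ⟨hxH, hx⟩, rfl⟩
      · exact zero_mem _
  have hfree := isFreeProduct_of_injective_lift hinj {i | deg i < n}
  rw [hspan] at hfree
  refine ⟨lt_of_le_of_ne hfree.1 fun heq => ?_, _, hfree⟩
  -- Properness: a free generator of degree at least `n` is not in the subalgebra generated by those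
  -- of degree below `n`.
  obtain ⟨i, hi⟩ := hlarge
  have hmem : h i ∈ LieSubalgebra.lieSpan F _ (h '' {i | deg i < n}) := by
    rw [hspan, heq]
    exact ⟨FreeLieAlgebra.of F i, by simp⟩
  have himage : h '' {i | deg i < n} =
      FreeLieAlgebra.lift F h '' (FreeLieAlgebra.of F '' {i | deg i < n}) := by
    rw [Set.image_image]
    simp
  rw [himage, ← LieSubalgebra.map_lieSpan] at hmem
  obtain ⟨p, hp, hpi⟩ := hmem
  have hpi' : p = FreeLieAlgebra.of F i := hinj (by simpa using hpi)
  exact of_notMem_lieSpan (S := {i | deg i < n}) (by simpa using hi) (hpi' ▸ hp)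

/-- A free Lie algebra on at most one generator has dimension at most one, hence no proper nonzero
subalgebra. -/
theorem nontrivial_of_ne_bot_of_ne_top (hbot : H ≠ ⊥) (htop : H ≠ ⊤) : Nontrivial X := by
  by_contra hX
  rw [not_nontrivial_iff_subsingleton] at hX
  refine htop (eq_top_of_forall_of_mem H fun x => ?_)
  have hspan : (LieSubalgebra.lieSpan F _ {FreeLieAlgebra.of F x}) = ⊤ :=
    eq_top_of_forall_of_mem _ fun y => Subsingleton.elim x y ▸ LieSubalgebra.subset_lieSpan rfl
  obtain ⟨u, hu, hu0⟩ : ∃ u ∈ H, u ≠ 0 := by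
    by_contra! hcon
    exact hbot ((LieSubalgebra.eq_bot_iff H).2 hcon)
  have hmul : ∃ a : F, u = a • FreeLieAlgebra.of F x := by
    have hu' : u ∈ LieSubalgebra.lieSpan F _ {FreeLieAlgebra.of F x} := hspan ▸ LieSubalgebra.mem_top u
    clear hu hu0
    induction hu' using LieSubalgebra.lieSpan_induction with
    | mem y hy => exact ⟨1, by simpa using hy⟩
    | zero => exact ⟨0, by simp⟩
    | add y z _ _ hy hz =>
      obtain ⟨a, rfl⟩ := hy
      obtain ⟨c, rfl⟩ := hz
      exact ⟨a + c, (add_smul _ _ _).symm⟩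
    | smul r y _ hy =>
      obtain ⟨a, rfl⟩ := hy
      exact ⟨r * a, (mul_smul _ _ _).symm⟩
    | lie y z _ _ hy hz =>
      obtain ⟨a, rfl⟩ := hy
      obtain ⟨c, rfl⟩ := hz
      exact ⟨0, by simp⟩
  obtain ⟨a, rfl⟩ := hmul
  have ha : a ≠ 0 := fun h => hu0 (by rw [h, zero_smul])
  simpa [smul_smul, inv_mul_cancel₀ ha] using H.smul_mem a⁻¹ hu

theorem isFreeFactor_bot_top : IsFreeFactor (⊥ : LieSubalgebra F (FreeLieAlgebra F X)) ⊤ := by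
  refine ⟨⊤, bot_le, le_rfl, fun M _ _ f g => ⟨g, ⟨?_, ?_⟩, ?_⟩⟩
  · ext ⟨x, hx⟩
    obtain rfl := (LieSubalgebra.mem_bot x).1 hx
    exact (map_zero _).trans (map_zero f).symm
  · rfl
  · rintro r ⟨-, rfl⟩
    rfl

end Truncation

end LieSub

/-! ### The main theorem. -/

theorem corollary2 {F : Type u} [Field F] {X : Type v} [Finite X]
    (H : LieSubalgebra F (FreeLieAlgebra F X)) (hfg : LieSub.IsFG H) (hproper : H ≠ ⊤) :
    (∃ C : LieSubalgebra F (FreeLieAlgebra F X), H < C ∧ LieSub.IsFreeFactor H C) ∧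
    (LieSub.IsHomogeneous H →
      ∃ C : LieSubalgebra F (FreeLieAlgebra F X),
        H < C ∧ LieSub.IsSubideal C ∧ LieSub.IsFreeFactor H C) := by
  classical
  open LieSub in
  -- The zero subalgebra is separated off because elimination needs two generators, which are
  -- guaranteed only when `H` is proper and nonzero.
  by_cases hbot : H = ⊥
  · subst hbot
    exact ⟨⟨⊤, hproper.lt_top, isFreeFactor_bot_top⟩, fun _ => ⟨⊤, hproper.lt_top,
      ⟨1, le_rfl, fun _ => ⊤, rfl, rfl, fun _ _ => ⟨le_rfl, fun _ _ _ _ => trivial⟩⟩,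
      isFreeFactor_bot_top⟩⟩
  have := nontrivial_of_ne_bot_of_ne_top hbot hproper
  obtain ⟨n₁, hn₁⟩ := exists_truncation_ne_top hproper
  obtain ⟨n₂, hn₂⟩ := exists_generators_mem_below hfg
  -- The summand 1 makes the subideal chain have positive length.
  obtain ⟨n, h₁, h₂, hn⟩ : ∃ n, n₁ ≤ n ∧ n₂ ≤ n ∧ 1 ≤ n := ⟨n₁ + n₂ + 1, by omega⟩
  obtain ⟨κ, deg, b, hb, -, hdeg⟩ :=
    exists_isGradedFree (isGraded_truncation H n) fun k hk => homog_le_truncation hk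
  have hlarge := hdeg (hn₁ n h₁) n
  have hlead (i : κ) (hi : deg i < n) : b i ∈ leading H (deg i) := by
    have hbi : b i ∈ truncation H n := by
      rw [← hb.lieSpan_eq]
      exact LieSubalgebra.subset_lieSpan ⟨i, rfl⟩
    simpa [proj_of_mem (hb.mem_homog i)] using mem_truncation.1 hbi (deg i) hi
  constructor
  · have hlift (i : κ) : ∃ x, x - b i ∈ below (fun _ => 1) (deg i) ∧ (deg i < n → x ∈ H) := by
      by_cases hi : deg i < n
      · obtain ⟨x, ⟨hxH, hx⟩, hxb⟩ := hlead i hi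
        exact ⟨x, hxb ▸ sub_proj_mem_below hx, fun _ => hxH⟩
      -- Generators of degree at least `n` stay unchanged; they generate the complementary factor.
      · exact ⟨b i, by simp, fun h => absurd h hi⟩
    choose h hh hH using hlift
    exact ⟨_, isFreeFactor_of_lifts (hn₂ n h₂) hb hlarge hh hH⟩
  · intro hhom
    have hH (i : κ) (hi : deg i < n) : b i ∈ H := by
      obtain ⟨x, ⟨hxH, -⟩, hxb⟩ := hlead i hi
      exact hxb ▸ hhom.isGraded x hxH _
    -- Here the lifts are the `b i` themselves, so the perturbation is zero and `C` is the
    -- truncation.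
    obtain ⟨hlt, hfactor⟩ := isFreeFactor_of_lifts (hn₂ n h₂) hb hlarge (by simp) hH
    rw [hb.range_eq] at hlt hfactor
    exact ⟨_, hlt, isSubideal_truncation H hn, hfactor⟩
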